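/- Let $n\ge 1$. A transitive factorization of a permutation $\pi\in S_n$ is a tuple $F=(\sigma_r,\dots,\sigma_1)$ of permutations in $S_n$ (with $r\ge 0$) such that $\pi=\sigma_r\cdots\sigma_1$ and the group $\langle\sigma_1,\dots,\sigma_r\rangle$ acts transitively on $\{1,\dots,n\}$. Writing $\ell(\sigma)$ for the number of cycles of $\sigma$ (fixed points included), $F$ is called minimal transitive if $nr-\sum_{j=1}^r\ell(\sigma_j)=n+\ell(\pi)-2$. A cycle factorization of $\pi$ is a minimal transitive factorization all of whose factors are cycles of length at least two; it has cycle index $\vec\imath=(i_2,i_3,\dots)$ if, for every $k\ge 2$, exactly $i_k$ of its factors are $k$-cycles. **Theorem (Springer).** Let $n\ge 1$, let $\vec\imath=(i_2,i_3,\dots)$ be a sequence of nonnegative integers with only finitely many nonzero terms, and set $r=i_2+i_3+\cdots$. Then the number of cycle factorizations of the full cycle $(1\,2\,\cdots\,n)$ with cycle index $\vec\imath$ is $$\frac{n^{r-1}\,r!}{\prod_{k\ge 2} i_k!}$$ if $n+r-1=\sum_{k\ge 2}k\,i_k$, and zero otherwise. -/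

import Mathlib

namespace CycleFact

/-- The number of cycles of a permutation of `n` points, every fixed point counting as a cycle
of length one. -/
def numCycles {n : ℕ} (σ : Equiv.Perm (Fin n)) : ℕ :=
  Multiset.card σ.partition.parts

/-- The tuple `F = (σ_r, …, σ_1)`, written as the list with entries in this order, is a
transitive factorization of `π`: one has `π = σ_r ⋯ σ_1`, and the group generated by the factors
acts transitively on the `n` points. -/
structure IsTransitiveFactorization {n : ℕ} (π : Equiv.Perm (Fin n))
    (F : List (Equiv.Perm (Fin n))) : Prop where
  prod_eq : F.prod = π
  transitive : MulAction.IsPretransitive (Subgroup.closure {σ | σ ∈ F}) (Fin n)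

/-- A minimal transitive factorization: a transitive factorization with
`n r - ∑ j, ℓ(σ_j) = n + ℓ(π) - 2`, where `r` is the number of factors and `ℓ` the number of
cycles. The equation is one between integers. -/
structure IsMinimalTransitiveFactorization {n : ℕ} (π : Equiv.Perm (Fin n))
    (F : List (Equiv.Perm (Fin n))) : Prop extends IsTransitiveFactorization π F where
  minimal : (n : ℤ) * (F.length : ℤ) - (F.map fun σ => (numCycles σ : ℤ)).sum
    = (n : ℤ) + (numCycles π : ℤ) - 2

/-- A cycle factorization: a minimal transitive factorization all of whose factors are cycles of
length at least two (the identity is not a cycle in the sense of `Equiv.Perm.IsCycle`). -/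
structure IsCycleFactorization {n : ℕ} (π : Equiv.Perm (Fin n))
    (F : List (Equiv.Perm (Fin n))) : Prop extends IsMinimalTransitiveFactorization π F where
  isCycle : ∀ σ ∈ F, σ.IsCycle

/-- The tuple `F` (of cycles) has cycle index `(i 2, i 3, …)`: for every `k ≥ 2` exactly `i k` of
its factors are cycles of length `k`. -/
def HasCycleIndex {n : ℕ} (F : List (Equiv.Perm (Fin n))) (i : ℕ →₀ ℕ) : Prop :=
  ∀ k : ℕ, 2 ≤ k → F.countP (fun σ => σ.support.card = k) = i k

/-- The set of cycle factorizations of `π` with cycle index `(i 2, i 3, …)`. -/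
def cycleFactorizations {n : ℕ} (π : Equiv.Perm (Fin n)) (i : ℕ →₀ ℕ) :
    Set (List (Equiv.Perm (Fin n))) :=
  {F | IsCycleFactorization π F ∧ HasCycleIndex F i}

end CycleFact

namespace CycleFact
open Equiv Equiv.Perm Finset

/-! ### Cycles of a product `σ * π` with `σ` a cycle -/

section General

variable {α : Type*} [Fintype α] [DecidableEq α]

/-! Fix the lengths of the factors in order and build the product from the right. Multiplying `π` by
an `l`-cycle lowers the number of cycles by at most `l - 1`, with equality exactly when its points
lie in distinct cycles of `π`, which are then merged (`classCount_add_one_le`,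
`separates_of_classCount_le`, `classCount_mul_of_separates`). Passing from `n` cycles to one with
total rank `n - 1` forces equality at every step (`card_le_classCount_prod_add`).

These sequences of merging cycles are counted with a weight, the number of transversals of the
cycles of the product. A merging cycle `σ` with a transversal of `σ * π` amounts to a transversal
`R` of `π`, an arbitrary point `v`, and an ordered choice of `l - 1` points of `R` outside the cycle
of `v`: `σ` runs through `v` and the chosen points, and the latter are deleted from `R`. If `π` has
`c` cycles, one step thus multiplies the weight by `n (c - 1) ⋯ (c - l + 1)` (`sum_mergingCycles`),
and the factors telescope to `n ^ r (n - 1)!` (`sum_mergingLists`).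

A full cycle has `n` transversals, and the `(n - 1)!` full cycles are conjugate, so each has `n ^ (r
- 1)` factorizations with the given lengths (`ncard_cycleLists`). The order of the lengths plays no
role, and there are `r! / ∏ i_k!` orders (`card_lists_mul_prod_factorial`). -/

theorem sameCycle_mul_of_disjoint_cycle {σ π : Perm α} {x : α}
    (h : ∀ y, SameCycle π x y → y ∉ σ.support) (y : α) :
    SameCycle (σ * π) x y ↔ SameCycle π x y := by
  have key : ∀ j : ℕ, ((σ * π) ^ j) x = (π ^ j) x := by
    intro j
    induction j with
    | zero => rfl
    | succ j ih =>
      rw [pow_succ', Perm.mul_apply, ih, Perm.mul_apply, ← Perm.mul_apply π, ← pow_succ',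
        ← Perm.notMem_support]
      exact h _ ⟨(j + 1 : ℕ), by rw [zpow_natCast]⟩
  constructor
  · intro hxy
    obtain ⟨j, hj⟩ := hxy.exists_nat_pow_eq
    exact ⟨j, by rw [← hj, key]; simp⟩
  · intro hxy
    obtain ⟨j, hj⟩ := hxy.exists_nat_pow_eq
    exact ⟨j, by rw [← hj, ← key]; simp⟩

/-- The points of `A` lie in pairwise distinct cycles of `π`. -/
def Separates (π : Perm α) (A : Finset α) : Prop :=
  ∀ ⦃a⦄, a ∈ A → ∀ ⦃b⦄, b ∈ A → SameCycle π a b → a = b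

/-- Starting at `a`, the product follows the `π`-cycle of `a`, which contains no other point moved
by `σ`. Only on the return to `a` does `σ` act, and it sends the path on to `σ a`. -/
theorem sameCycle_mul_of_separates_aux {σ π : Perm α} (hs : Separates π σ.support) {a : α}
    (ha : a ∈ σ.support) :
    (∀ y, SameCycle π a y → SameCycle (σ * π) a y) ∧ SameCycle (σ * π) a (σ a) := by
  classical
  -- The least such `m` is the length of the `π`-cycle of `a`.
  have hex : ∃ m : ℕ, 0 < m ∧ (π ^ m) a = a :=
    ⟨orderOf π, orderOf_pos π, by rw [pow_orderOf_eq_one]; rfl⟩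
  obtain ⟨hm0, hm⟩ := Nat.find_spec hex
  set m := Nat.find hex
  have key : ∀ j : ℕ, j < m → ((σ * π) ^ j) a = (π ^ j) a := by
    intro j
    induction j with
    | zero => intro _; rfl
    | succ j ih =>
      intro hj
      rw [pow_succ', Perm.mul_apply, ih (by omega), Perm.mul_apply, ← Perm.mul_apply π,
        ← pow_succ', ← Perm.notMem_support]
      intro hmem
      have := hs ha hmem ⟨(j + 1 : ℕ), by rw [zpow_natCast]⟩
      exact Nat.find_min hex hj ⟨by omega, this.symm⟩
  constructor
  · intro y hy
    obtain ⟨j, hj⟩ := hy.exists_nat_pow_eq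
    have hper : ((π ^ m) ^ (j / m)) a = a := by
      generalize j / m = q
      induction q with
      | zero => rfl
      | succ q ih => rw [pow_succ', Perm.mul_apply, ih, hm]
    refine ⟨(j % m : ℕ), ?_⟩
    rw [zpow_natCast, key _ (Nat.mod_lt _ hm0), ← hj]
    conv_rhs => rw [← Nat.mod_add_div j m, pow_add, Perm.mul_apply, pow_mul, hper]
  · refine ⟨(m : ℕ), ?_⟩
    obtain ⟨p, hp⟩ : ∃ p, m = p + 1 := ⟨m - 1, by omega⟩
    rw [zpow_natCast, hp, pow_succ', Perm.mul_apply, key p (by omega), Perm.mul_apply,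
      ← Perm.mul_apply π, ← pow_succ', ← hp, hm]

/-- Multiplying by a cycle whose points lie in distinct cycles merges these cycles. -/
theorem sameCycle_mul_of_separates {σ π : Perm α} (hσ : σ.IsCycle)
    (hs : Separates π σ.support) (x y : α) :
    SameCycle (σ * π) x y ↔ SameCycle π x y ∨
      ∃ a ∈ σ.support, ∃ b ∈ σ.support, SameCycle π x a ∧ SameCycle π b y := by
  have hA : ∀ a ∈ σ.support, ∀ b ∈ σ.support, SameCycle (σ * π) a b := by
    intro a ha b hb
    have hab := hσ.sameCycle (mem_support.1 ha) (mem_support.1 hb)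
    obtain ⟨j, rfl⟩ := hab.exists_nat_pow_eq
    clear hab hb
    induction j with
    | zero => exact SameCycle.refl _ _
    | succ j ih =>
      rw [pow_succ', Perm.mul_apply]
      exact ih.trans (sameCycle_mul_of_separates_aux hs (pow_apply_mem_support.2 ha)).2
  constructor
  · intro h
    obtain ⟨j, rfl⟩ := h.exists_nat_pow_eq
    clear h
    induction j with
    | zero => exact Or.inl (SameCycle.refl _ _)
    | succ j ih =>
      rw [pow_succ', Perm.mul_apply, Perm.mul_apply]
      set z := ((σ * π) ^ j) x
      by_cases hz : π z ∈ σ.support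
      · right
        rcases ih with ih | ⟨a, ha, b, hb, hxa, hbz⟩
        · exact ⟨π z, hz, σ (π z), apply_mem_support.2 hz, sameCycle_apply_right.2 ih,
            SameCycle.refl _ _⟩
        · exact ⟨a, ha, σ (π z), apply_mem_support.2 hz, hxa, SameCycle.refl _ _⟩
      · rw [notMem_support.1 hz]
        rcases ih with ih | ⟨a, ha, b, hb, hxa, hbz⟩
        · exact Or.inl (sameCycle_apply_right.2 ih)
        · exact Or.inr ⟨a, ha, b, hb, hxa, sameCycle_apply_right.2 hbz⟩
  · rintro (h | ⟨a, ha, b, hb, hxa, hby⟩)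
    · by_cases hx : ∃ a ∈ σ.support, SameCycle π a x
      · obtain ⟨a, ha, hax⟩ := hx
        have := (sameCycle_mul_of_separates_aux hs ha).1
        exact (this x hax).symm.trans (this y (hax.trans h))
      · push Not at hx
        exact (sameCycle_mul_of_disjoint_cycle (fun z hz hz' => hx z hz' hz.symm) y).2 h
    · exact (((sameCycle_mul_of_separates_aux hs ha).1 x hxa.symm).symm.trans
        (hA a ha b hb)).trans ((sameCycle_mul_of_separates_aux hs hb).1 y hby)

/-! ### Transversals and the number of cycles -/

/-- `R` contains exactly one point of every cycle of `π`. -/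
def IsTransversal (π : Perm α) (R : Finset α) : Prop :=
  ∀ x, ∃! y, y ∈ R ∧ SameCycle π x y

/-- The number of cycles of `π`, counted as classes of `SameCycle`. -/
noncomputable def classCount (π : Perm α) : ℕ := Nat.card (Quotient (SameCycle.setoid π))

omit [DecidableEq α] in
theorem classCount_le_card {π : Perm α} {S : Finset α} (h : ∀ x, ∃ y ∈ S, SameCycle π x y) :
    classCount π ≤ #S := by
  rw [classCount, ← Fintype.card_coe, ← Nat.card_eq_fintype_card]
  refine Nat.card_le_card_of_surjective
    (fun y : S => (Quotient.mk (SameCycle.setoid π) (y : α))) ?_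
  intro q
  induction q using Quotient.inductionOn with
  | h x =>
    obtain ⟨y, hy, hxy⟩ := h x
    exact ⟨⟨y, hy⟩, Quotient.sound hxy.symm⟩

omit [DecidableEq α] in
theorem IsTransversal.card_eq {π : Perm α} {R : Finset α} (h : IsTransversal π R) :
    #R = classCount π := by
  refine le_antisymm ?_ (classCount_le_card fun x => ?_)
  · rw [classCount, ← Fintype.card_coe, ← Nat.card_eq_fintype_card]
    refine Nat.card_le_card_of_injective
      (fun y : R => (Quotient.mk (SameCycle.setoid π) (y : α))) ?_
    intro y z hyz
    have := Quotient.exact hyz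
    exact Subtype.ext ((h y).unique ⟨y.2, SameCycle.refl _ _⟩ ⟨z.2, this⟩)
  · obtain ⟨y, hy, _⟩ := h x
    exact ⟨y, hy⟩

theorem exists_isTransversal (π : Perm α) : ∃ R, IsTransversal π R := by
  classical
  refine ⟨univ.image fun q : Quotient (SameCycle.setoid π) => q.out, fun x => ?_⟩
  refine ⟨(Quotient.mk (SameCycle.setoid π) x).out, ⟨by simp, ?_⟩, ?_⟩
  · exact (Quotient.mk_out (s := SameCycle.setoid π) x).symm
  · rintro y ⟨hy, hxy⟩
    obtain ⟨q, -, rfl⟩ := mem_image.1 hy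
    have : q = Quotient.mk (SameCycle.setoid π) x := by
      rw [← Quotient.out_eq q]; exact Quotient.sound hxy.symm
    rw [this]

/-- A cycle of `π` that avoids the support of `σ` is also a cycle of `σ * π`, and not the one
through `a`. So `T` can be a transversal of `σ * π` without its representative of that cycle. -/
theorem exists_cover_of_mul {σ π : Perm α} {a : α} (ha : a ∈ σ.support) :
    ∃ T : Finset α, #T + 1 = classCount (σ * π) ∧
      ∀ x, (∀ y ∈ σ.support, ¬ SameCycle π x y) → ∃ y ∈ T, SameCycle π x y := by
  obtain ⟨R, hR⟩ := exists_isTransversal (σ * π)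
  obtain ⟨t, ⟨htR, hat⟩, -⟩ := hR a
  refine ⟨R.erase t, by rw [card_erase_add_one htR, hR.card_eq], fun x hx => ?_⟩
  obtain ⟨y, ⟨hy, hxy⟩, -⟩ := hR x
  have hw := sameCycle_mul_of_disjoint_cycle (σ := σ) (π := π) (x := x)
    (fun z hz hz' => hx z hz' hz)
  refine ⟨y, mem_erase.2 ⟨?_, hy⟩, (hw y).1 hxy⟩
  rintro rfl
  exact hx a ha ((hw a).1 (hxy.trans hat.symm))

theorem classCount_add_one_le {σ π : Perm α} (hσ : σ.IsCycle) :
    classCount π + 1 ≤ classCount (σ * π) + #σ.support := by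
  obtain ⟨a, ha, -⟩ := id hσ
  obtain ⟨T, hT, hcov⟩ := exists_cover_of_mul (π := π) (mem_support.2 ha)
  have : classCount π ≤ #(T ∪ σ.support) := classCount_le_card fun x => by
    by_cases hx : ∀ y ∈ σ.support, ¬ SameCycle π x y
    · obtain ⟨y, hy, hxy⟩ := hcov x hx
      exact ⟨y, mem_union_left _ hy, hxy⟩
    · push Not at hx
      obtain ⟨y, hy, hxy⟩ := hx
      exact ⟨y, mem_union_right _ hy, hxy⟩
  have := this.trans (card_union_le _ _)
  omega

/-- If two points of the support shared a cycle of `π`, one of them could be left out of the cover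
that bounds `classCount π`, which makes the bound strict. -/
theorem separates_of_classCount_le {σ π : Perm α}
    (h : classCount (σ * π) + #σ.support ≤ classCount π + 1) : Separates π σ.support := by
  intro b hb c hc hbc
  by_contra hne
  obtain ⟨T, hT, hcov⟩ := exists_cover_of_mul (π := π) hb
  have : classCount π ≤ #(T ∪ σ.support.erase b) := classCount_le_card fun x => by
    by_cases hx : ∀ y ∈ σ.support, ¬ SameCycle π x y
    · obtain ⟨y, hy, hxy⟩ := hcov x hx
      exact ⟨y, mem_union_left _ hy, hxy⟩
    · push Not at hx
      obtain ⟨y, hy, hxy⟩ := hx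
      by_cases hyb : y = b
      · subst hyb
        exact ⟨c, mem_union_right _ (mem_erase.2 ⟨fun h => hne h.symm, hc⟩), hxy.trans hbc⟩
      · exact ⟨y, mem_union_right _ (mem_erase.2 ⟨hyb, hy⟩), hxy⟩
  have h1 := this.trans (card_union_le _ _)
  have h2 := card_erase_add_one hb
  omega

/-- Transversals of the merged permutation arise from those of `π` by deleting the points of the
merging cycle other than `v`. -/
theorem IsTransversal.sdiff {σ π : Perm α} (hσ : σ.IsCycle) (hs : Separates π σ.support)
    {R : Finset α} (hR : IsTransversal π R) {v : α} (hv : v ∈ σ.support)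
    (hvR : σ.support.erase v ⊆ R) : IsTransversal (σ * π) (R \ σ.support.erase v) := by
  obtain ⟨r, ⟨hrR, hvr⟩, hru⟩ := hR v
  have hr : r ∉ σ.support.erase v := fun h =>
    (mem_erase.1 h).1 (hs hv (mem_erase.1 h).2 hvr).symm
  have hRs : ∀ y ∈ R, y ∉ σ.support.erase v → ∀ b ∈ σ.support, SameCycle π b y → b = v := by
    intro y hy hyn b hb hby
    by_contra hbv
    have hbR := hvR (mem_erase.2 ⟨hbv, hb⟩)
    have := (hR b).unique ⟨hbR, SameCycle.refl _ _⟩ ⟨hy, hby⟩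
    exact hyn (this ▸ mem_erase.2 ⟨hbv, hb⟩)
  intro x
  by_cases hx : ∃ a ∈ σ.support, SameCycle π x a
  · obtain ⟨a, ha, hxa⟩ := hx
    refine ⟨r, ⟨mem_sdiff.2 ⟨hrR, hr⟩, (sameCycle_mul_of_separates hσ hs x r).2
      (Or.inr ⟨a, ha, v, hv, hxa, hvr⟩)⟩, ?_⟩
    rintro y ⟨hy, hxy⟩
    obtain ⟨hyR, hyn⟩ := mem_sdiff.1 hy
    have : ∃ b ∈ σ.support, SameCycle π b y := by
      rcases (sameCycle_mul_of_separates hσ hs x y).1 hxy with h | ⟨_, _, b, hb, _, hby⟩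
      · exact ⟨a, ha, hxa.symm.trans h⟩
      · exact ⟨b, hb, hby⟩
    obtain ⟨b, hb, hby⟩ := this
    have hbv := hRs y hyR hyn b hb hby
    subst hbv
    exact hru y ⟨hyR, hby⟩
  · push Not at hx
    have hiff := sameCycle_mul_of_disjoint_cycle (σ := σ) (π := π) (x := x)
      (fun y hxy hy => hx y hy hxy)
    obtain ⟨y, ⟨hyR, hxy⟩, hyu⟩ := hR x
    refine ⟨y, ⟨mem_sdiff.2 ⟨hyR, fun h => hx y (mem_erase.1 h).2 hxy⟩, (hiff y).2 hxy⟩, ?_⟩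
    rintro z ⟨hz, hxz⟩
    exact hyu z ⟨(mem_sdiff.1 hz).1, (hiff z).1 hxz⟩

theorem IsTransversal.exists_root {σ π : Perm α} (hσ : σ.IsCycle) (hs : Separates π σ.support)
    {R : Finset α} (hR : IsTransversal (σ * π) R) :
    ∃ v ∈ σ.support, ∃ x ∈ R, SameCycle π v x := by
  obtain ⟨a, ha, -⟩ := id hσ
  obtain ⟨x, ⟨hx, hax⟩, -⟩ := hR a
  rcases (sameCycle_mul_of_separates hσ hs a x).1 hax with h | ⟨_, _, b, hb, _, hbx⟩
  · exact ⟨a, mem_support.2 ha, x, hx, h⟩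
  · exact ⟨b, hb, x, hx, hbx⟩

/-- All cycles of `π` through the support become one, so `R` has a single point there; it singles
out the one `v` whose former cycle contains it. This makes the correspondence of
`RootedChoice.toMerge` reversible. -/
theorem IsTransversal.root_unique {σ π : Perm α} (hσ : σ.IsCycle) (hs : Separates π σ.support)
    {R : Finset α} (hR : IsTransversal (σ * π) R) {v w x y : α} (hv : v ∈ σ.support)
    (hx : x ∈ R) (hvx : SameCycle π v x) (hw : w ∈ σ.support) (hy : y ∈ R)
    (hwy : SameCycle π w y) : v = w := by
  have hxy : SameCycle (σ * π) x y :=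
    (sameCycle_mul_of_separates hσ hs x y).2 (Or.inr ⟨v, hv, w, hw, hvx.symm, hwy⟩)
  have := (hR x).unique ⟨hx, SameCycle.refl _ _⟩ ⟨hy, hxy⟩
  subst this
  exact hs hv hw (hvx.trans hwy.symm)

theorem IsTransversal.disjoint_erase {σ π : Perm α} (hσ : σ.IsCycle)
    (hs : Separates π σ.support) {R : Finset α} (hR : IsTransversal (σ * π) R) {v x : α}
    (hv : v ∈ σ.support) (hx : x ∈ R) (hvx : SameCycle π v x) :
    Disjoint R (σ.support.erase v) := by
  rw [disjoint_left]
  intro y hy hye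
  obtain ⟨hne, hys⟩ := mem_erase.1 hye
  exact hne (hR.root_unique hσ hs hv hx hvx hys hy (SameCycle.refl _ _)).symm

/-- Among the merged cycles only that of `v` is already represented in `R`; each of the others is
represented by its own point of the support. -/
theorem IsTransversal.union {σ π : Perm α} (hσ : σ.IsCycle) (hs : Separates π σ.support)
    {R : Finset α} (hR : IsTransversal (σ * π) R) {v x : α} (hv : v ∈ σ.support) (hx : x ∈ R)
    (hvx : SameCycle π v x) : IsTransversal π (R ∪ σ.support.erase v) := by
  intro z
  by_cases hz : ∃ b ∈ σ.support, SameCycle π z b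
  · obtain ⟨b, hb, hzb⟩ := hz
    by_cases hbv : b = v
    · subst hbv
      refine ⟨x, ⟨mem_union_left _ hx, hzb.trans hvx⟩, ?_⟩
      rintro y ⟨hy, hzy⟩
      have hby := hzb.symm.trans hzy
      rcases mem_union.1 hy with hy | hy
      · have hxy : SameCycle (σ * π) x y :=
          (sameCycle_mul_of_separates hσ hs x y).2 (Or.inl (hvx.symm.trans hby))
        exact (hR x).unique ⟨hy, hxy⟩ ⟨hx, SameCycle.refl _ _⟩
      · obtain ⟨hne, hys⟩ := mem_erase.1 hy
        exact absurd (hs hv hys hby).symm hne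
    · refine ⟨b, ⟨mem_union_right _ (mem_erase.2 ⟨hbv, hb⟩), hzb⟩, ?_⟩
      rintro y ⟨hy, hzy⟩
      have hby := hzb.symm.trans hzy
      rcases mem_union.1 hy with hy | hy
      · exact absurd (hR.root_unique hσ hs hb hy hby hv hx hvx) hbv
      · exact (hs hb (mem_erase.1 hy).2 hby).symm
  · push Not at hz
    have hiff := sameCycle_mul_of_disjoint_cycle (σ := σ) (π := π) (x := z)
      (fun y hzy hy => hz y hy hzy)
    obtain ⟨y, ⟨hyR, hzy⟩, hyu⟩ := hR z
    refine ⟨y, ⟨mem_union_left _ hyR, (hiff y).1 hzy⟩, ?_⟩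
    rintro w ⟨hw, hzw⟩
    rcases mem_union.1 hw with hw | hw
    · exact hyu w ⟨hw, (hiff w).2 hzw⟩
    · exact absurd hzw (hz w (mem_erase.1 hw).2)

theorem classCount_mul_of_separates {σ π : Perm α} (hσ : σ.IsCycle)
    (hs : Separates π σ.support) :
    classCount (σ * π) + #σ.support = classCount π + 1 := by
  obtain ⟨R, hR⟩ := exists_isTransversal (σ * π)
  obtain ⟨v, hv, x, hx, hvx⟩ := hR.exists_root hσ hs
  rw [← hR.card_eq, ← (hR.union hσ hs hv hx hvx).card_eq,
    card_union_of_disjoint (hR.disjoint_erase hσ hs hv hx hvx), add_assoc, card_erase_add_one hv]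

/-! ### The bijection between rooted choices and rooted merges -/

/-- The number of transversals of the cycles of `π`. -/
noncomputable def transversalCount (π : Perm α) : ℕ := Nat.card {R : Finset α // IsTransversal π R}

/-- The possible ways to choose a point `v`, and `m` distinct points of a transversal outside the
cycle of `v`. -/
abbrev RootedChoice (π : Perm α) (m : ℕ) : Type _ :=
  Σ R : {R : Finset α // IsTransversal π R}, Σ v : α,
    (Fin m ↪ {x // x ∈ R.1 ∧ ¬ SameCycle π v x})

/-- The cycles of length `l` that merge `l` cycles of `π`, with a transversal of the product. -/
abbrev RootedMerge (π : Perm α) (l : ℕ) : Type _ :=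
  Σ σ : {σ : Perm α // σ.IsCycle ∧ #σ.support = l ∧ Separates π σ.support},
    {R : Finset α // IsTransversal (σ.1 * π) R}

namespace RootedChoice

variable {π : Perm α} {m : ℕ}

/-- The chosen points, beginning with `v`. -/
def list (p : RootedChoice π m) : List α := p.2.1 :: List.ofFn fun j => (p.2.2 j : α)

omit [Fintype α] [DecidableEq α] in
theorem list_length (p : RootedChoice π m) : p.list.length = m + 1 := by simp [list]

omit [Fintype α] [DecidableEq α] in
theorem list_nodup (p : RootedChoice π m) : p.list.Nodup := by
  rw [list, List.nodup_cons, List.mem_ofFn, List.nodup_ofFn]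
  refine ⟨?_, fun i j h => p.2.2.injective (Subtype.ext h)⟩
  rintro ⟨j, hj⟩
  have h := (p.2.2 j).2.2
  rw [hj] at h
  exact h (SameCycle.refl _ _)

omit [Fintype α] in
theorem formPerm_pow_root (p : RootedChoice π m) (i : ℕ) (hi : i < p.list.length) :
    (p.list.formPerm ^ i) p.2.1 = p.list[i] := by
  have := List.formPerm_pow_apply_getElem p.list p.list_nodup i 0 (by omega)
  simp only [Nat.zero_add, Nat.mod_eq_of_lt hi] at this
  exact this

theorem support_formPerm (p : RootedChoice π (m + 1)) :
    p.list.formPerm.support = p.list.toFinset :=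
  List.support_formPerm_of_nodup _ p.list_nodup fun x h => by
    have := p.list_length
    rw [h] at this
    simp at this

omit [Fintype α] in
theorem isCycle (p : RootedChoice π (m + 1)) : p.list.formPerm.IsCycle :=
  List.isCycle_formPerm p.list_nodup (by rw [list_length]; omega)

theorem mem_support (p : RootedChoice π (m + 1)) {x : α} :
    x ∈ p.list.formPerm.support ↔ x = p.2.1 ∨ ∃ j, (p.2.2 j : α) = x := by
  rw [p.support_formPerm, List.mem_toFinset, list, List.mem_cons, List.mem_ofFn]

theorem erase_subset (p : RootedChoice π (m + 1)) :
    p.list.formPerm.support.erase p.2.1 ⊆ p.1.1 := by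
  intro x hx
  obtain ⟨hne, hx⟩ := mem_erase.1 hx
  rcases p.mem_support.1 hx with h | ⟨j, rfl⟩
  · exact absurd h hne
  · exact (p.2.2 j).2.1

theorem separates (p : RootedChoice π (m + 1)) : Separates π p.list.formPerm.support := by
  intro a ha b hb hab
  rcases p.mem_support.1 ha with rfl | ⟨i, rfl⟩ <;> rcases p.mem_support.1 hb with rfl | ⟨j, rfl⟩
  · rfl
  · exact absurd hab (p.2.2 j).2.2
  · exact absurd hab.symm (p.2.2 i).2.2
  · exact (p.1.2 _).unique ⟨(p.2.2 i).2.1, SameCycle.refl _ _⟩ ⟨(p.2.2 j).2.1, hab⟩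

/-- The merging cycle through the chosen points, with the remaining transversal. -/
def toMerge (p : RootedChoice π (m + 1)) : RootedMerge π (m + 2) :=
  ⟨⟨p.list.formPerm, p.isCycle, by
      rw [p.support_formPerm, List.toFinset_card_of_nodup p.list_nodup, list_length],
      p.separates⟩,
    ⟨p.1.1 \ p.list.formPerm.support.erase p.2.1,
      p.1.2.sdiff p.isCycle p.separates (p.mem_support.2 (Or.inl rfl)) p.erase_subset⟩⟩

theorem exists_root_mem (p : RootedChoice π (m + 1)) :
    ∃ x ∈ p.1.1 \ p.list.formPerm.support.erase p.2.1, SameCycle π p.2.1 x := by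
  obtain ⟨x, ⟨hx, hvx⟩, -⟩ := p.1.2 p.2.1
  refine ⟨x, mem_sdiff.2 ⟨hx, fun h => ?_⟩, hvx⟩
  obtain ⟨hne, hs⟩ := mem_erase.1 h
  exact hne (p.separates (p.mem_support.2 (Or.inl rfl)) hs hvx).symm

/-- The image determines `v` by `root_unique`, then the transversal by restoring the deleted points,
then the list of chosen points as the successive images of `v` under the cycle. -/
theorem toMerge_injective : Function.Injective (toMerge (π := π) (m := m)) := by
  intro p q h
  have h1 : p.list.formPerm = q.list.formPerm := congrArg (fun t => (t.1 : Perm α)) h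
  have h2 : p.1.1 \ p.list.formPerm.support.erase p.2.1 =
    q.1.1 \ q.list.formPerm.support.erase q.2.1 := congrArg (fun t => (t.2 : Finset α)) h
  obtain ⟨x, hx, hpx⟩ := p.exists_root_mem
  obtain ⟨y, hy, hqy⟩ := q.exists_root_mem
  have hv : p.2.1 = q.2.1 :=
    (toMerge p).2.2.root_unique p.isCycle p.separates (p.mem_support.2 (Or.inl rfl)) hx hpx
      (h1 ▸ q.mem_support.2 (Or.inl rfl)) (h2.symm ▸ hy : y ∈ p.1.1 \ _) hqy
  have hR : p.1.1 = q.1.1 := by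
    rw [← sdiff_union_of_subset p.erase_subset, ← sdiff_union_of_subset q.erase_subset, h2, h1, hv]
  have hl : p.list = q.list := by
    refine List.ext_getElem (by rw [list_length, list_length]) fun i hi hi' => ?_
    rw [← p.formPerm_pow_root i hi, ← q.formPerm_pow_root i hi', h1, hv]
  obtain ⟨⟨R, hRt⟩, v, e⟩ := p
  obtain ⟨⟨R', hRt'⟩, v', e'⟩ := q
  simp only at hv hR
  subst hv hR
  have : e = e' := by
    ext j
    have := List.cons_injective hl
    exact congrFun (List.ofFn_injective this) j
  rw [this]

theorem toMerge_surjective : Function.Surjective (toMerge (π := π) (m := m)) := by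
  rintro ⟨⟨σ, hσ, hcard, hs⟩, ⟨R, hR⟩⟩
  obtain ⟨v, hv, x, hx, hvx⟩ := hR.exists_root hσ hs
  have hlen : (σ.toList v).length = m + 2 := by
    rw [Equiv.Perm.length_toList, hσ.cycleOf_eq (Equiv.Perm.mem_support.1 hv), hcard]
  have hget : ∀ j : Fin (m + 1), (σ ^ (j.1 + 1)) v ∈ σ.support.erase v := by
    intro j
    refine mem_erase.2 ⟨fun h => ?_, pow_apply_mem_support.2 hv⟩
    have h0 := σ.nodup_toList v
    have e1 : (σ.toList v)[j.1 + 1]'(by rw [hlen]; omega) = (σ.toList v)[0]'(by rw [hlen]; omega) := by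
      rw [getElem_toList, getElem_toList, h]; rfl
    rw [h0.getElem_inj_iff] at e1
    omega
  let e : Fin (m + 1) ↪ {x // x ∈ R ∪ σ.support.erase v ∧ ¬ SameCycle π v x} :=
    { toFun := fun j => ⟨(σ ^ (j.1 + 1)) v, mem_union_right _ (hget j), fun h =>
        (mem_erase.1 (hget j)).1 (hs hv (mem_erase.1 (hget j)).2 h).symm⟩
      inj' := by
        intro i j hij
        have h := congrArg Subtype.val hij
        change (σ ^ (i.1 + 1)) v = (σ ^ (j.1 + 1)) v at h
        have h0 := σ.nodup_toList v
        have e1 : (σ.toList v)[i.1 + 1]'(by rw [hlen]; omega) =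
            (σ.toList v)[j.1 + 1]'(by rw [hlen]; omega) := by
          rw [getElem_toList, getElem_toList, h]
        rw [h0.getElem_inj_iff] at e1
        exact Fin.ext (by omega) }
  -- The preimage reads `σ` as a list that begins at its root `v`.
  let p : RootedChoice π (m + 1) := ⟨⟨R ∪ σ.support.erase v, hR.union hσ hs hv hx hvx⟩, v, e⟩
  have hp : p.list = σ.toList v := by
    refine List.ext_getElem (by rw [list_length, hlen]) fun i hi hi' => ?_
    rw [getElem_toList]
    cases i with
    | zero => rfl
    | succ i => simp only [p, list, List.getElem_cons_succ, List.getElem_ofFn]; rfl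
  have hσp : p.list.formPerm = σ := by
    rw [hp, formPerm_toList, hσ.cycleOf_eq (Equiv.Perm.mem_support.1 hv)]
  refine ⟨p, ?_⟩
  have h2 : p.1.1 \ p.list.formPerm.support.erase p.2.1 = R := by
    rw [hσp]
    exact union_sdiff_cancel_right (hR.disjoint_erase hσ hs hv hx hvx)
  refine Sigma.ext (Subtype.ext hσp) ?_
  exact (Subtype.heq_iff_coe_eq (fun S => by simp [toMerge, hσp])).2 h2

end RootedChoice

theorem card_rootedChoice (π : Perm α) (m : ℕ) :
    Nat.card (RootedChoice π m) =
      transversalCount π * (Fintype.card α * (classCount π - 1).descFactorial m) := by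
  classical
  have hone : ∀ (R : {R : Finset α // IsTransversal π R}) (v : α),
      Fintype.card {x // x ∈ R.1 ∧ ¬ SameCycle π v x} = classCount π - 1 := by
    intro R v
    obtain ⟨y, ⟨hy, hvy⟩, hyu⟩ := R.2 v
    -- Only the representative `y` of the cycle of `v` is excluded.
    rw [← R.2.card_eq, ← card_erase_of_mem hy]
    refine Fintype.card_of_subtype _ fun x => ?_
    rw [mem_erase]
    constructor
    · rintro ⟨hne, hx⟩
      exact ⟨hx, fun h => hne (hyu x ⟨hx, h⟩)⟩
    · rintro ⟨hx, h⟩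
      exact ⟨fun h' => h (h' ▸ hvy), hx⟩
  have htwo : ∀ R : {R : Finset α // IsTransversal π R},
      Nat.card (Σ v : α, (Fin m ↪ {x // x ∈ R.1 ∧ ¬ SameCycle π v x})) =
        Fintype.card α * (classCount π - 1).descFactorial m := by
    intro R
    have : ∀ v : α, Nat.card (Fin m ↪ {x // x ∈ R.1 ∧ ¬ SameCycle π v x}) =
        (classCount π - 1).descFactorial m := fun v => by
      rw [Nat.card_eq_fintype_card, Fintype.card_embedding_eq, hone, Fintype.card_fin]
    rw [Nat.card_sigma, sum_congr rfl fun v _ => this v, sum_const, card_univ, smul_eq_mul]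
  rw [Nat.card_sigma, sum_congr rfl fun R _ => htwo R, sum_const, card_univ, smul_eq_mul,
    transversalCount, Nat.card_eq_fintype_card]

theorem card_rootedMerge (π : Perm α) (l : ℕ) (hl : 2 ≤ l) :
    Nat.card (RootedMerge π l) =
      transversalCount π * (Fintype.card α * (classCount π - 1).descFactorial (l - 1)) := by
  obtain ⟨m, rfl⟩ : ∃ m, l = m + 2 := ⟨l - 2, by omega⟩
  rw [← Nat.card_eq_of_bijective _
    ⟨RootedChoice.toMerge_injective (π := π) (m := m), RootedChoice.toMerge_surjective⟩,
    card_rootedChoice]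
  rfl

open Classical in
/-- The cycles of length `l` meeting every cycle of `π` at most once. -/
noncomputable def mergingCycles (π : Perm α) (l : ℕ) : Finset (Perm α) :=
  univ.filter fun σ => σ.IsCycle ∧ #σ.support = l ∧ Separates π σ.support

theorem mem_mergingCycles {π σ : Perm α} {l : ℕ} :
    σ ∈ mergingCycles π l ↔ σ.IsCycle ∧ #σ.support = l ∧ Separates π σ.support := by
  classical
  simp [mergingCycles]

theorem sum_mergingCycles (π : Perm α) (l : ℕ) (hl : 2 ≤ l) :
    ∑ σ ∈ mergingCycles π l, transversalCount (σ * π) =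
      transversalCount π * (Fintype.card α * (classCount π - 1).descFactorial (l - 1)) := by
  classical
  rw [← card_rootedMerge π l hl, Nat.card_sigma]
  exact Finset.sum_subtype _ (fun σ => mem_mergingCycles) _

/-! ### Lists of merging cycles -/

/-- The sum of the numbers `l - 1`, the rank of a product of cycles with lengths `l ∈ L`. -/
def rankSum (L : List ℕ) : ℕ := (L.map fun l => l - 1).sum

@[simp] theorem rankSum_nil : rankSum [] = 0 := rfl

@[simp] theorem rankSum_cons (l : ℕ) (L : List ℕ) : rankSum (l :: L) = (l - 1) + rankSum L := by
  simp [rankSum]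

variable (α) in
/-- The lists of cycles with lengths `L` each of which, from right to left, merges cycles of the
product of the subsequent ones. -/
noncomputable def mergingLists : List ℕ → Finset (List (Perm α))
  | [] => {[]}
  | l :: L => (mergingLists L).biUnion fun F => (mergingCycles F.prod l).image fun σ => σ :: F

theorem cons_mem_mergingLists {σ : Perm α} {F : List (Perm α)} {l : ℕ} {L : List ℕ} :
    σ :: F ∈ mergingLists α (l :: L) ↔ F ∈ mergingLists α L ∧ σ ∈ mergingCycles F.prod l := by
  simp [mergingLists]

theorem classCount_one : classCount (1 : Perm α) = Fintype.card α := by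
  have h : IsTransversal (1 : Perm α) univ := fun x =>
    ⟨x, ⟨mem_univ _, SameCycle.refl _ _⟩, fun y hy => (sameCycle_one.1 hy.2).symm⟩
  rw [← h.card_eq, card_univ]

omit [DecidableEq α] in
theorem transversalCount_one : transversalCount (1 : Perm α) = 1 := by
  rw [transversalCount, Nat.card_eq_one_iff_unique]
  refine ⟨⟨fun R S => Subtype.ext ?_⟩, ⟨⟨univ, fun x =>
    ⟨x, ⟨mem_univ _, SameCycle.refl _ _⟩, fun y hy => (sameCycle_one.1 hy.2).symm⟩⟩⟩⟩
  have key : ∀ T : {R : Finset α // IsTransversal (1 : Perm α) R}, T.1 = univ := fun T => by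
    refine eq_univ_of_forall fun x => ?_
    obtain ⟨y, ⟨hy, hxy⟩, -⟩ := T.2 x
    rwa [sameCycle_one.1 hxy]
  rw [key R, key S]

/-- Since the number of cycles depends on `L` alone, the factor contributed by the next cycle is the
same for all lists, and the weighted sum becomes a product. -/
theorem classCount_prod_of_mem_mergingLists {L : List ℕ} :
    ∀ {F : List (Perm α)}, F ∈ mergingLists α L →
      classCount F.prod + rankSum L = Fintype.card α := by
  induction L with
  | nil =>
    intro F hF
    rw [mergingLists, mem_singleton] at hF
    subst hF
    simp [classCount_one]
  | cons l L ih =>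
    intro F hF
    simp only [mergingLists, mem_biUnion, mem_image] at hF
    obtain ⟨F, hF, σ, hσ, rfl⟩ := hF
    obtain ⟨hc, hl, hs⟩ := mem_mergingCycles.1 hσ
    have h1 := ih hF
    have h2 := classCount_mul_of_separates hc hs
    have h3 := hc.two_le_card_support
    rw [List.prod_cons, rankSum_cons]
    omega

theorem sum_mergingLists (L : List ℕ) (hL : ∀ l ∈ L, 2 ≤ l) :
    ∑ F ∈ mergingLists α L, transversalCount F.prod =
      Fintype.card α ^ L.length * (Fintype.card α - 1).descFactorial (rankSum L) := by
  induction L with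
  | nil => simp [mergingLists, transversalCount_one]
  | cons l L ih =>
    have hl := hL l List.mem_cons_self
    specialize ih fun k hk => hL k (List.mem_cons_of_mem _ hk)
    rw [mergingLists, sum_biUnion]
    · have : ∀ F ∈ mergingLists α L,
          ∑ G ∈ (mergingCycles F.prod l).image (fun σ => σ :: F), transversalCount G.prod =
            transversalCount F.prod * (Fintype.card α *
              (Fintype.card α - 1 - rankSum L).descFactorial (l - 1)) := by
        intro F hF
        rw [sum_image fun σ _ τ _ h => (List.cons.inj h).1]
        simp only [List.prod_cons]
        have := classCount_prod_of_mem_mergingLists hF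
        rw [sum_mergingCycles _ _ hl,
          show classCount F.prod - 1 = Fintype.card α - 1 - rankSum L by omega]
      rw [sum_congr rfl this, ← sum_mul, ih, rankSum_cons, List.length_cons, pow_succ,
        ← Nat.descFactorial_mul_descFactorial (Nat.le_add_left (rankSum L) (l - 1)),
        Nat.add_sub_cancel]
      ring
    · intro F _ G _ hne
      rw [Function.onFun, disjoint_left]
      intro H h1 h2
      obtain ⟨σ, -, rfl⟩ := mem_image.1 h1
      obtain ⟨τ, -, h⟩ := mem_image.1 h2
      exact hne (List.cons.inj h).2.symm

theorem isCycle_and_map_of_mem_mergingLists {L : List ℕ} :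
    ∀ {F : List (Perm α)}, F ∈ mergingLists α L →
      (∀ σ ∈ F, σ.IsCycle) ∧ F.map (fun σ => #σ.support) = L := by
  induction L with
  | nil =>
    intro F hF
    rw [mergingLists, mem_singleton] at hF
    subst hF
    simp
  | cons l L ih =>
    intro F hF
    simp only [mergingLists, mem_biUnion, mem_image] at hF
    obtain ⟨F, hF, σ, hσ, rfl⟩ := hF
    obtain ⟨hc, hl, -⟩ := mem_mergingCycles.1 hσ
    obtain ⟨h1, h2⟩ := ih hF
    exact ⟨List.forall_mem_cons.2 ⟨hc, h1⟩, by rw [List.map_cons, hl, h2]⟩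

/-- Each factor lowers the number of cycles by at most its length minus one. If the total drop is as
large as possible, no step has any slack, so every factor merges. -/
theorem card_le_classCount_prod_add (F : List (Perm α)) (hF : ∀ σ ∈ F, σ.IsCycle) :
    Fintype.card α ≤ classCount F.prod + rankSum (F.map fun σ => #σ.support) ∧
      (classCount F.prod + rankSum (F.map fun σ => #σ.support) ≤ Fintype.card α →
        F ∈ mergingLists α (F.map fun σ => #σ.support)) := by
  induction F with
  | nil => simp [classCount_one, mergingLists]
  | cons σ F ih =>
    obtain ⟨hσ, hF⟩ := List.forall_mem_cons.1 hF
    obtain ⟨h1, h2⟩ := ih hF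
    have h3 := classCount_add_one_le (π := F.prod) hσ
    have h4 := hσ.two_le_card_support
    simp only [List.map_cons, List.prod_cons, rankSum_cons]
    refine ⟨by omega, fun h => ?_⟩
    exact cons_mem_mergingLists.2 ⟨h2 (by omega),
      mem_mergingCycles.2 ⟨hσ, rfl, separates_of_classCount_le (by omega)⟩⟩

theorem mem_mergingLists_iff {L : List ℕ} (hL : rankSum L + 1 = Fintype.card α)
    {F : List (Perm α)} : F ∈ mergingLists α L ↔
      (∀ σ ∈ F, σ.IsCycle) ∧ F.map (fun σ => #σ.support) = L ∧ classCount F.prod = 1 := by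
  constructor
  · intro h
    obtain ⟨h1, h2⟩ := isCycle_and_map_of_mem_mergingLists h
    have := classCount_prod_of_mem_mergingLists h
    exact ⟨h1, h2, by omega⟩
  · rintro ⟨h1, rfl, h3⟩
    exact (card_le_classCount_prod_add F h1).2 (by omega)

/-! ### Full cycles and conjugation -/

omit [Fintype α] [DecidableEq α] in
theorem sameCycle_of_classCount_eq_one {π : Perm α} (h : classCount π = 1) (x y : α) :
    SameCycle π x y := by
  obtain ⟨hs, -⟩ := Nat.card_eq_one_iff_unique.1 h
  exact Quotient.exact (s := SameCycle.setoid π) (Subsingleton.elim _ _)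

omit [Fintype α] [DecidableEq α] in
theorem classCount_eq_one [Nonempty α] {π : Perm α} (h : ∀ x y, SameCycle π x y) :
    classCount π = 1 := by
  refine Nat.card_eq_one_iff_unique.2 ⟨⟨fun p q => ?_⟩,
    ⟨Quotient.mk _ (Classical.arbitrary α)⟩⟩
  induction p using Quotient.inductionOn with
  | h x =>
    induction q using Quotient.inductionOn with
    | h y => exact Quotient.sound (h x y)

theorem transversalCount_of_classCount_eq_one {π : Perm α} (h : classCount π = 1) :
    transversalCount π = Fintype.card α := by
  rw [transversalCount, ← Nat.card_eq_fintype_card]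
  symm
  refine Nat.card_eq_of_bijective (fun x : α => (⟨{x}, fun y =>
    ⟨x, ⟨mem_singleton_self x, sameCycle_of_classCount_eq_one h _ _⟩,
      fun z hz => mem_singleton.1 hz.1⟩⟩ : {R : Finset α // IsTransversal π R})) ⟨?_, ?_⟩
  · intro x y hxy
    exact singleton_injective (congrArg Subtype.val hxy)
  · rintro ⟨R, hR⟩
    obtain ⟨x, rfl⟩ := card_eq_one.1 (hR.card_eq.trans h)
    exact ⟨x, rfl⟩

theorem classCount_eq_one_iff_cycleType (hn : 2 ≤ Fintype.card α) {π : Perm α} :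
    classCount π = 1 ↔ π.cycleType = {Fintype.card α} := by
  have : Nontrivial α := Fintype.one_lt_card_iff_nontrivial.1 hn
  constructor
  · intro h
    have hs := sameCycle_of_classCount_eq_one h
    have hne : ∀ x, π x ≠ x := fun x hx => by
      obtain ⟨y, hy⟩ := exists_ne x
      exact hy ((hs x y).eq_of_left hx).symm
    obtain ⟨x⟩ := (inferInstance : Nonempty α)
    have hc : π.IsCycle := ⟨x, hne x, fun y _ => hs x y⟩
    rw [hc.cycleType, eq_univ_of_forall fun y => mem_support.2 (hne y), card_univ]
  · intro h
    have hc : π.IsCycle := card_cycleType_eq_one.1 (by rw [h, Multiset.card_singleton])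
    have hsum := π.sum_cycleType
    rw [h, Multiset.sum_singleton] at hsum
    have huniv := (card_eq_iff_eq_univ _).1 hsum.symm
    refine classCount_eq_one fun x y => hc.sameCycle ?_ ?_ <;>
      exact mem_support.1 (huniv ▸ mem_univ _)

variable (α) in
theorem card_classCount_eq_one [Nonempty α] [DecidablePred fun π : Perm α => classCount π = 1] :
    #(univ.filter fun π : Perm α => classCount π = 1) = (Fintype.card α - 1).factorial := by
  rcases Nat.lt_or_ge 1 (Fintype.card α) with hn | hn
  · rw [filter_congr fun π _ => classCount_eq_one_iff_cycleType hn,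
      card_of_cycleType_singleton hn le_rfl, Nat.choose_self, mul_one]
  -- A single point needs its own argument: `cycleType` omits fixed points, so the identity does not
  -- have cycle type `{1}`.
  · have : Subsingleton α := Fintype.card_le_one_iff_subsingleton.1 hn
    rw [filter_true_of_mem fun π _ => classCount_eq_one fun x y =>
      (Subsingleton.elim x y).sameCycle π, card_univ, Fintype.card_perm]
    have := Fintype.card_pos (α := α)
    rw [show Fintype.card α = 1 by omega]
    rfl

theorem isConj_of_classCount_eq_one {π τ : Perm α} (hπ : classCount π = 1)
    (hτ : classCount τ = 1) : IsConj π τ := by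
  rcases Nat.lt_or_ge 1 (Fintype.card α) with hn | hn
  · rw [isConj_iff_cycleType_eq, (classCount_eq_one_iff_cycleType hn).1 hπ,
      (classCount_eq_one_iff_cycleType hn).1 hτ]
  · have : Subsingleton α := Fintype.card_le_one_iff_subsingleton.1 hn
    rw [Subsingleton.elim π τ]

/-- The factorizations of `c` into cycles with lengths `L`. -/
def cycleLists (c : Perm α) (L : List ℕ) : Set (List (Perm α)) :=
  {F | F.prod = c ∧ (∀ σ ∈ F, σ.IsCycle) ∧ F.map (fun σ => #σ.support) = L}

theorem finite_cycleLists (c : Perm α) (L : List ℕ) : (cycleLists c L).Finite :=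
  (List.finite_length_eq (Perm α) L.length).subset fun F hF => by
    have := congrArg List.length hF.2.2
    rwa [List.length_map] at this

theorem map_conj_mem_cycleLists {c : Perm α} {L : List ℕ} {F : List (Perm α)}
    (hF : F ∈ cycleLists c L) (g : Perm α) :
    F.map (MulAut.conj g) ∈ cycleLists (g * c * g⁻¹) L := by
  obtain ⟨h1, h2, h3⟩ := hF
  refine ⟨?_, ?_, ?_⟩
  · rw [← map_list_prod, h1, MulAut.conj_apply]
  · intro σ hσ
    obtain ⟨τ, hτ, rfl⟩ := List.mem_map.1 hσ
    rw [MulAut.conj_apply]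
    exact (h2 τ hτ).conj
  · rw [← h3, List.map_map]
    refine List.map_congr_left fun σ _ => ?_
    simp [MulAut.conj_apply]

theorem ncard_cycleLists_le_of_isConj {c d : Perm α} (h : IsConj c d) (L : List ℕ) :
    (cycleLists c L).ncard ≤ (cycleLists d L).ncard := by
  obtain ⟨g, rfl⟩ := isConj_iff.1 h
  exact Set.ncard_le_ncard_of_injOn (List.map (MulAut.conj g))
    (fun F hF => map_conj_mem_cycleLists hF g)
    (List.map_injective_iff.2 (MulAut.conj g).injective).injOn (finite_cycleLists _ _)

/-- The number of factorizations of a full cycle into cycles of lengths `L`, in this order. -/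
theorem ncard_cycleLists [Nonempty α] {c : Perm α} (hc : classCount c = 1) {L : List ℕ}
    (hL : ∀ l ∈ L, 2 ≤ l) (hr : rankSum L + 1 = Fintype.card α) :
    Fintype.card α * (cycleLists c L).ncard = Fintype.card α ^ L.length := by
  classical
  have h1 := sum_mergingLists (α := α) L hL
  rw [sum_congr rfl fun F hF => transversalCount_of_classCount_eq_one
    ((mem_mergingLists_iff hr).1 hF).2.2, sum_const, smul_eq_mul, ← hr, Nat.add_sub_cancel,
    Nat.descFactorial_self, hr] at h1
  -- The lists are sorted by their product; conjugation in both directions makes all fibres over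
  -- full cycles equally large.
  have h2 : #(mergingLists α L) = (rankSum L).factorial * (cycleLists c L).ncard := by
    rw [card_eq_sum_card_fiberwise (f := List.prod)
      (t := univ.filter fun π : Perm α => classCount π = 1)
      (fun F hF => by simpa using ((mem_mergingLists_iff hr).1 hF).2.2)]
    have : ∀ d ∈ univ.filter (fun π : Perm α => classCount π = 1),
        #((mergingLists α L).filter fun F => F.prod = d) = (cycleLists c L).ncard := by
      intro d hd
      have hd := (mem_filter.1 hd).2
      rw [le_antisymm (ncard_cycleLists_le_of_isConj (isConj_of_classCount_eq_one hc hd) L)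
        (ncard_cycleLists_le_of_isConj (isConj_of_classCount_eq_one hd hc) L),
        ← Set.ncard_coe_finset]
      congr 1
      ext F
      rw [mem_coe, mem_filter, mem_mergingLists_iff hr, cycleLists, Set.mem_ofPred_eq]
      constructor
      · rintro ⟨⟨h1, h2, -⟩, h4⟩
        exact ⟨h4, h1, h2⟩
      · rintro ⟨h4, h1, h2⟩
        exact ⟨⟨h1, h2, h4 ▸ hd⟩, h4⟩
    rw [sum_congr rfl this, sum_const, smul_eq_mul, card_classCount_eq_one, ← hr,
      Nat.add_sub_cancel]
  rw [h2] at h1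
  refine Nat.eq_of_mul_eq_mul_left (Nat.factorial_pos (rankSum L)) ?_
  linarith

end General

/-! ### Orderings of a multiset -/

/-- Lists are split by their first entry `a`. Restoring `a` to the multiset multiplies the product
of factorials by `s.count a`, and these multiplicities sum to the length. The fixed set `T` keeps
the index set of the product unchanged when the last copy of `a` is erased. -/
theorem card_lists_mul_prod_factorial {β : Type*} [DecidableEq β] (T : Finset β) (m : ℕ) :
    ∀ s : Multiset β, Multiset.card s = m → s.toFinset ⊆ T →
      #s.lists.toFinset * ∏ k ∈ T, (s.count k).factorial = m.factorial := by
  induction m with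
  | zero =>
    intro s hs _
    rw [Multiset.card_eq_zero] at hs
    subst hs
    have : (0 : Multiset β).lists.toFinset = {[]} := by
      ext L
      rw [Multiset.mem_toFinset, Multiset.mem_lists_iff, mem_singleton]
      constructor
      · intro h
        exact (Multiset.coe_eq_zero L).1 h.symm
      · rintro rfl
        rfl
    simp [this]
  | succ m ih =>
    intro s hs hT
    have hunion : s.lists.toFinset =
        s.toFinset.biUnion fun a => (s.erase a).lists.toFinset.image (List.cons a) := by
      ext L
      simp only [Multiset.mem_toFinset, Multiset.mem_lists_iff, mem_biUnion, mem_image]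
      constructor
      · rintro rfl
        cases L with
        | nil => simp at hs
        | cons a L => exact ⟨a, by simp, L, by simp, rfl⟩
      · rintro ⟨a, ha, L, hL, rfl⟩
        change s = ((a :: L : List β) : Multiset β)
        rw [← Multiset.cons_coe, ← Multiset.cons_erase ha]
        exact congrArg _ hL
    rw [hunion, card_biUnion, sum_mul]
    · have : ∀ a ∈ s.toFinset, #((s.erase a).lists.toFinset.image (List.cons a)) *
          ∏ k ∈ T, (s.count k).factorial = m.factorial * s.count a := by
        intro a ha
        have haT := hT ha
        rw [Multiset.mem_toFinset] at ha
        rw [card_image_of_injective _ List.cons_injective,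
          ← ih (s.erase a) (by rw [Multiset.card_erase_of_mem ha, hs]; rfl)
            (fun k hk => hT (Multiset.mem_toFinset.2
              (Multiset.mem_of_mem_erase (Multiset.mem_toFinset.1 hk)))),
          ← mul_prod_erase T _ haT, ← mul_prod_erase T _ haT, Multiset.count_erase_self,
          ← Nat.mul_factorial_pred (Multiset.count_pos.2 ha).ne',
          prod_congr rfl fun k hk => by
            rw [← Multiset.count_erase_of_ne (s := s) (mem_erase.1 hk).1]]
        ring
      rw [sum_congr rfl this, ← mul_sum, Multiset.toFinset_sum_count_eq, hs, Nat.factorial_succ,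
        mul_comm]
    · intro a _ b _ hab
      rw [Function.onFun, disjoint_left]
      intro L h1 h2
      obtain ⟨K, -, rfl⟩ := mem_image.1 h1
      obtain ⟨K', -, h⟩ := mem_image.1 h2
      exact hab (List.cons.inj h).1.symm

/-! ### Cycle factorizations of the full cycle -/

theorem numCycles_of_isCycle {n : ℕ} {σ : Perm (Fin n)} (hσ : σ.IsCycle) :
    (numCycles σ : ℤ) = n - #σ.support + 1 := by
  have h : #σ.support ≤ n := by simpa using card_le_univ σ.support
  rw [numCycles, parts_partition, hσ.cycleType]
  simp only [Multiset.card_add, Multiset.card_singleton, Multiset.card_replicate, Fintype.card_fin]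
  omega

theorem sum_numCycles {n : ℕ} (F : List (Perm (Fin n))) (hF : ∀ σ ∈ F, σ.IsCycle) :
    (n : ℤ) * (F.length : ℤ) - (F.map fun σ => (numCycles σ : ℤ)).sum =
      ((F.map fun σ => #σ.support).sum : ℕ) - (F.length : ℤ) := by
  induction F with
  | nil => simp
  | cons σ F ih =>
    obtain ⟨hσ, hF⟩ := List.forall_mem_cons.1 hF
    specialize ih hF
    simp only [List.map_cons, List.sum_cons, List.length_cons, numCycles_of_isCycle hσ]
    push_cast at ih ⊢
    linarith

theorem rankSum_add_length {L : List ℕ} (hL : ∀ l ∈ L, 2 ≤ l) :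
    rankSum L + L.length = L.sum := by
  induction L with
  | nil => rfl
  | cons l L ih =>
    obtain ⟨hl, hL⟩ := List.forall_mem_cons.1 hL
    rw [rankSum_cons, List.length_cons, List.sum_cons, ← ih hL]
    omega

theorem classCount_finRotate {n : ℕ} (hn : 1 ≤ n) : classCount (finRotate n) = 1 := by
  obtain ⟨n, rfl⟩ : ∃ m, n = m + 1 := ⟨n - 1, by omega⟩
  cases n with
  | zero => exact classCount_eq_one fun x y => (Subsingleton.elim (α := Fin 1) x y).sameCycle _
  | succ n =>
    rw [classCount_eq_one_iff_cycleType (by simp), cycleType_finRotate, Fintype.card_fin]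

theorem numCycles_finRotate {n : ℕ} (hn : 1 ≤ n) : numCycles (finRotate n) = 1 := by
  obtain ⟨n, rfl⟩ : ∃ m, n = m + 1 := ⟨n - 1, by omega⟩
  cases n with
  | zero =>
    rw [show finRotate (0 + 1) = 1 from Subsingleton.elim (α := Perm (Fin 1)) _ _]
    simp [numCycles, parts_partition]
  | succ n => simp [numCycles, parts_partition, cycleType_finRotate, support_finRotate]

/-- The powers of the product lie in the generated subgroup and already act transitively, so
transitivity costs nothing for factorizations of a full cycle. -/
theorem isPretransitive_closure_of_prod {n : ℕ} {F : List (Perm (Fin n))}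
    (h : classCount F.prod = 1) :
    MulAction.IsPretransitive (Subgroup.closure {σ | σ ∈ F}) (Fin n) := by
  refine ⟨fun x y => ?_⟩
  obtain ⟨j, hj⟩ := sameCycle_of_classCount_eq_one h x y
  exact ⟨⟨F.prod ^ j, zpow_mem (list_prod_mem fun σ hσ => Subgroup.subset_closure hσ) j⟩, hj⟩

theorem hasCycleIndex_iff {n : ℕ} {F : List (Perm (Fin n))} (hF : ∀ σ ∈ F, σ.IsCycle) {i : ℕ →₀ ℕ}
    (hi : ∀ k : ℕ, k < 2 → i k = 0) : HasCycleIndex F i ↔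
      ((F.map fun σ => #σ.support : List ℕ) : Multiset ℕ) = Finsupp.toMultiset i := by
  have hcount : ∀ k, (F.map fun σ => #σ.support).count k = F.countP (fun σ => #σ.support = k) := by
    intro k
    rw [List.count, List.countP_map]
    refine List.countP_congr fun σ _ => ?_
    simp
  rw [Multiset.ext]
  simp only [Multiset.coe_count, hcount, Finsupp.count_toMultiset]
  refine ⟨fun h k => ?_, fun h k _ => h k⟩
  -- The cycle index says nothing about `k < 2`; there both sides vanish, as a cycle moves at least
  -- two points.
  rcases Nat.lt_or_ge k 2 with hk | hk
  · rw [hi k hk, List.countP_eq_zero]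
    intro σ hσ h'
    have := (hF σ hσ).two_le_card_support
    rw [of_decide_eq_true h'] at this
    omega
  · exact h k hk

theorem sum_toMultiset (i : ℕ →₀ ℕ) : (Finsupp.toMultiset i).sum = i.sum fun k m => k * m := by
  rw [Finsupp.toMultiset_apply, Finsupp.sum, Multiset.sum_sum, Finsupp.sum]
  exact sum_congr rfl fun k _ => by rw [Multiset.sum_nsmul, Multiset.sum_singleton, smul_eq_mul,
    mul_comm]

theorem two_le_of_mem {i : ℕ →₀ ℕ} (hi : ∀ k : ℕ, k < 2 → i k = 0) {L : List ℕ}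
    (hL : (L : Multiset ℕ) = Finsupp.toMultiset i) : ∀ l ∈ L, 2 ≤ l := by
  intro l hl
  have : l ∈ Finsupp.toMultiset i := hL ▸ Multiset.mem_coe.2 hl
  rw [Finsupp.mem_toMultiset, Finsupp.mem_support_iff] at this
  by_contra h
  exact this (hi l (by omega))

/-- A cycle satisfies `n - ℓ(σ) = #σ.support - 1`, so minimality is a condition on the cycle index
alone. It is the numerical condition of the theorem, and without it there are no factorizations. -/
theorem mem_cycleFactorizations_iff {n : ℕ} (hn : 1 ≤ n) {i : ℕ →₀ ℕ}
    (hi : ∀ k : ℕ, k < 2 → i k = 0) {F : List (Perm (Fin n))} :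
    F ∈ cycleFactorizations (finRotate n) i ↔
      ((n : ℤ) + ((i.sum fun _ m => m : ℕ) : ℤ) - 1 = ((i.sum fun k m => k * m : ℕ) : ℤ)) ∧
        ((F.map fun σ => #σ.support : List ℕ) : Multiset ℕ) = Finsupp.toMultiset i ∧
          F ∈ cycleLists (finRotate n) (F.map fun σ => #σ.support) := by
  have key : ((F.map fun σ => #σ.support : List ℕ) : Multiset ℕ) = Finsupp.toMultiset i →
      F.length = (i.sum fun _ m => m) ∧
        (F.map fun σ => #σ.support).sum = i.sum fun k m => k * m := by
    intro h
    constructor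
    · have := congrArg Multiset.card h
      rw [Multiset.coe_card, List.length_map, Finsupp.card_toMultiset] at this
      exact this
    · rw [← sum_toMultiset, ← h, Multiset.sum_coe]
  constructor
  · rintro ⟨⟨⟨⟨hp, ht⟩, hm⟩, hc⟩, hidx⟩
    have hL := (hasCycleIndex_iff hc hi).1 hidx
    rw [sum_numCycles F hc, (key hL).1, (key hL).2, numCycles_finRotate hn] at hm
    exact ⟨by push_cast at hm ⊢; linarith, hL, hp, hc, rfl⟩
  · rintro ⟨hm, hL, hp, hc, -⟩
    refine ⟨⟨⟨⟨hp, isPretransitive_closure_of_prod (hp ▸ classCount_finRotate hn)⟩, ?_⟩, hc⟩,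
      (hasCycleIndex_iff hc hi).2 hL⟩
    rw [sum_numCycles F hc, (key hL).1, (key hL).2, numCycles_finRotate hn]
    push_cast at hm ⊢
    linarith

theorem finite_cycleFactorizations {n : ℕ} (hn : 1 ≤ n) {i : ℕ →₀ ℕ}
    (hi : ∀ k : ℕ, k < 2 → i k = 0) : (cycleFactorizations (finRotate n) i).Finite := by
  refine (List.finite_length_eq (Perm (Fin n)) (Multiset.card (Finsupp.toMultiset i))).subset ?_
  intro F hF
  rw [Set.mem_ofPred_eq, ← ((mem_cycleFactorizations_iff hn hi).1 hF).2.1, Multiset.coe_card,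
    List.length_map]

theorem mul_ncard_cycleFactorizations {n : ℕ} (hn : 1 ≤ n) {i : ℕ →₀ ℕ}
    (hi : ∀ k : ℕ, k < 2 → i k = 0)
    (h : (n : ℤ) + ((i.sum fun _ m => m : ℕ) : ℤ) - 1 = ((i.sum fun k m => k * m : ℕ) : ℤ)) :
    n * (cycleFactorizations (finRotate n) i).ncard =
      #(Finsupp.toMultiset i).lists.toFinset * n ^ (i.sum fun _ m => m) := by
  have : NeZero n := ⟨by omega⟩
  have hfin := finite_cycleFactorizations hn hi
  rw [Set.ncard_eq_toFinset_card _ hfin,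
    card_eq_sum_card_fiberwise (f := fun F : List (Perm (Fin n)) => F.map fun σ => #σ.support)
      (t := (Finsupp.toMultiset i).lists.toFinset), mul_sum]
  · have : ∀ L ∈ (Finsupp.toMultiset i).lists.toFinset,
        n * #(hfin.toFinset.filter fun F => (F.map fun σ => #σ.support) = L) =
          n ^ (i.sum fun _ m => m) := by
      intro L hL
      rw [Multiset.mem_toFinset, Multiset.mem_lists_iff] at hL
      replace hL : (L : Multiset ℕ) = Finsupp.toMultiset i := hL.symm
      have h2 := two_le_of_mem hi hL
      have hlen : L.length = i.sum fun _ m => m := by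
        have := congrArg Multiset.card hL
        rwa [Multiset.coe_card, Finsupp.card_toMultiset] at this
      have hsum : L.sum = i.sum fun k m => k * m := by
        rw [← sum_toMultiset, ← hL, Multiset.sum_coe]
      have hr := rankSum_add_length h2
      have hmain := ncard_cycleLists (classCount_finRotate hn) h2
        (by rw [Fintype.card_fin]; omega)
      rw [Fintype.card_fin, hlen] at hmain
      rw [← hmain, ← Set.ncard_coe_finset]
      congr 2
      ext F
      rw [mem_coe, mem_filter, Set.Finite.mem_toFinset, mem_cycleFactorizations_iff hn hi]
      constructor
      · rintro ⟨⟨-, -, hF⟩, rfl⟩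
        exact hF
      · intro hF
        obtain rfl := hF.2.2
        exact ⟨⟨h, hL, hF⟩, rfl⟩
    rw [sum_congr rfl this, sum_const, smul_eq_mul]
  · intro F hF
    rw [mem_coe, Set.Finite.mem_toFinset, mem_cycleFactorizations_iff hn hi] at hF
    rw [mem_coe, Multiset.mem_toFinset, Multiset.mem_lists_iff]
    exact hF.2.1.symm

end CycleFact

theorem theorem3 (n : ℕ) (hn : 1 ≤ n) (i : ℕ →₀ ℕ) (hi : ∀ k : ℕ, k < 2 → i k = 0)
    (r : ℕ) (hr : r = i.sum fun _ m => m) :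
    (CycleFact.cycleFactorizations (finRotate n) i).Finite ∧
    ((n : ℤ) + (r : ℤ) - 1 = ((i.sum fun k m => k * m : ℕ) : ℤ) →
      ((CycleFact.cycleFactorizations (finRotate n) i).ncard : ℚ) =
        (n : ℚ) ^ ((r : ℤ) - 1) * (Nat.factorial r : ℚ)
          / ((i.prod fun _ m => Nat.factorial m : ℕ) : ℚ)) ∧
    ((n : ℤ) + (r : ℤ) - 1 ≠ ((i.sum fun k m => k * m : ℕ) : ℤ) →
      (CycleFact.cycleFactorizations (finRotate n) i).ncard = 0) := by
  refine ⟨CycleFact.finite_cycleFactorizations hn hi, fun h => ?_, fun h => ?_⟩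
  · rw [hr] at h
    have h1 := CycleFact.mul_ncard_cycleFactorizations hn hi h
    have h2 := CycleFact.card_lists_mul_prod_factorial i.support r (Finsupp.toMultiset i)
      (by rw [Finsupp.card_toMultiset, hr]; rfl) (by rw [Finsupp.toFinset_toMultiset])
    simp only [Finsupp.count_toMultiset] at h2
    rw [← hr] at h1
    have hn0 : (n : ℚ) ≠ 0 := by
      have : n ≠ 0 := by omega
      exact_mod_cast this
    have hprod : (i.prod fun _ m => Nat.factorial m) ≠ 0 :=
      Finset.prod_ne_zero_iff.2 fun k _ => Nat.factorial_ne_zero _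
    -- The exponent `r - 1` is an integer because `r = 0` does occur, for `n = 1`.
    rw [zpow_sub_one₀ hn0, zpow_natCast, eq_div_iff (by exact_mod_cast hprod), ← h2]
    have h1' : (n : ℚ) * ((CycleFact.cycleFactorizations (finRotate n) i).ncard : ℚ) =
        ((Finsupp.toMultiset i).lists.toFinset.card : ℚ) * (n : ℚ) ^ r := by exact_mod_cast h1
    rw [Finsupp.prod, Nat.cast_mul]
    field_simp
    linear_combination h1'
  · rw [Set.ncard_eq_zero (CycleFact.finite_cycleFactorizations hn hi)]
    refine Set.eq_empty_of_forall_notMem fun F hF => h ?_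
    rw [hr]
    exact ((CycleFact.mem_cycleFactorizations_iff hn hi).1 hF).1
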